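/- For integers $d,k$ and real $\lambda>0$, let $P(d,k,\lambda)$ be the set of multilinear polynomials $p(x)=\sum_{S\subseteq[d],\,|S|\le k}\widehat p(S)\prod_{i\in S}x_i$ on $\{-1,1\}^d$ of degree at most $k$ with real coefficients satisfying $\|p\|_1:=\sum_S|\widehat p(S)|\le\lambda$, and let $\ell(z)=\log(1+e^{-z})$ be the logistic loss. There exists an absolute constant $C>0$ such that the following holds. Let $\lambda>0$, let $d\ge 2$, $1\le k\le d$ and $T\ge 2$ be integers, and let $Z^1=(X^1,Y^1),\ldots,Z^T=(X^T,Y^T)$ be any stochastic process with values in $\{-1,1\}^d\times\{-1,1\}$. Then for every $u>0$, with probability at least $1-\exp\left(-\frac{u^2}{C\lambda^2T}\right)$, $$\sup_{p\in P(d,k,\lambda)}\left(\sum_{t=1}^T\mathbb{E}\left[\ell\left(2\,Y^{t}\,p(X^{t})\right)\,\middle|\,Z^1,\ldots,Z^{t-1}\right]-\sum_{t=1}^T\ell\left(2\,Y^{t}\,p(X^{t})\right)\right)\le C\lambda\,\log^{3/2}(T)\,\sqrt{T\,k\,\log d}+u .$$ -/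

import Mathlib

open MeasureTheory

noncomputable section

/-- The Boolean cube `{-1,1}^d`; the two-point set `{-1,1}` is the type `ℤˣ`. -/
abbrev Cube (d : ℕ) : Type := Fin d → ℤˣ

/-- A multilinear polynomial in `d` variables, given by its vector of coefficients: `p S` is the
coefficient of the monomial `∏ i ∈ S, x i`. -/
abbrev CubePoly (d : ℕ) : Type := Finset (Fin d) → ℝ

namespace CubePoly

variable {d : ℕ}

/-- The value `p(x) = ∑_S p_S ∏_{i ∈ S} x_i` at a point of the cube. -/
def eval (p : CubePoly d) (x : Cube d) : ℝ :=
  ∑ S : Finset (Fin d), p S * ∏ i ∈ S, ((x i : ℤ) : ℝ)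

/-- The sum of the absolute values of the coefficients. -/
def l1Norm (p : CubePoly d) : ℝ :=
  ∑ S : Finset (Fin d), |p S|

/-- Every monomial with a nonzero coefficient has degree at most `k`. -/
def DegreeLE (p : CubePoly d) (k : ℕ) : Prop :=
  ∀ S : Finset (Fin d), p S ≠ 0 → S.card ≤ k

end CubePoly

/-- The class `P(d, k, r)` of polynomials on the cube of degree at most `k` with `ℓ₁`-norm of the
coefficients at most `r`. -/
def boundedPolys (d k : ℕ) (r : ℝ) : Set (CubePoly d) :=
  {p | p.DegreeLE k ∧ p.l1Norm ≤ r}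

/-- The logistic loss `z ↦ log (1 + exp (-z))`. -/
def logisticLoss (z : ℝ) : ℝ :=
  Real.log (1 + Real.exp (-z))

/-- The loss `ℓ(2 · y · p(x))` of the polynomial `p` at the labelled sample `z = (x, y)`. -/
def sampleLoss {d : ℕ} (p : CubePoly d) (z : Cube d × ℤˣ) : ℝ :=
  logisticLoss (2 * ((z.2 : ℤ) : ℝ) * p.eval z.1)

/-- The sigma-algebra generated by the terms of the process strictly before time `t`. -/
abbrev strictPast {Ω E : Type*} [MeasurableSpace E] {T : ℕ} (Z : Fin T → Ω → E) (t : Fin T) :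
    MeasurableSpace Ω :=
  ⨆ s : Fin T, ⨆ _ : s < t, MeasurableSpace.comap (Z s) inferInstance

/-- The sum over time of the conditional expected losses of `p` given the strict past, minus the
sum of the observed losses of `p`, at the outcome `ω`. -/
def lossGap {Ω : Type*} [MeasurableSpace Ω] (μ : Measure Ω) {d T : ℕ}
    (Z : Fin T → Ω → Cube d × ℤˣ) (p : CubePoly d) (ω : Ω) : ℝ :=
  ∑ t : Fin T, (μ[fun ω' => sampleLoss p (Z t ω') | strictPast Z t]) ω
    - ∑ t : Fin T, sampleLoss p (Z t ω)

end

/-! For one function `D` of the sample, the predicted minus observed sum is a martingale.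
Subtracting its observed and predictable quadratic variations makes the exponential a
supermartingale, so each fixed `D` has a self-normalised tail bound
(`measureReal_predGap_sub_predQuad_ge_le`).

Uniformity over polynomials comes from chaining. Up to the factor `r`, `y * p x` is a convex
combination of signed monomials, whose number `N` satisfies `log N ≤ 3 k log d`. Maurey's argument
approximates it by averages of `2 ^ j - 1` monomials, with squared error `r ^ 2 / 2 ^ j` relative to
the total mass. The weights are the random observed plus predicted masses. This is harmless: the
approximants may depend on the outcome, while the union bound runs over all tuples of monomials, a
fixed finite set.

Level `j` has at most `N ^ (3 * 2 ^ j)` links of quadratic variation of order `r ^ 2 * T / 2 ^ j`.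
The powers of two cancel, so every level costs order `r * √(T log N)`, and order `log T` levels
suffice. This gives `log T`, which is at most twice the stated `log ^ (3/2) T`. -/

/-! ### The one-step exponential inequality. -/

/-- Symmetrisation: Jensen replaces the means by an independent copy `z'`, exchanging `z` and `z'`
turns the exponential into a `cosh`, and `cosh x ≤ exp (x ^ 2 / 2)` is absorbed by the two squares.
No bound on `D` is needed. -/
theorem sum_mul_exp_centered_le_one {E : Type*} [Fintype E] {q : E → ℝ} (hq : ∀ z, 0 ≤ q z)
    (hq1 : ∑ z, q z = 1) (D : E → ℝ) :
    ∑ z, q z * Real.exp ((∑ z', q z' * D z') - D z - (D z ^ 2 + ∑ z', q z' * D z' ^ 2)) ≤ 1 := by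
  have jensen : ∀ z, Real.exp ((∑ z', q z' * D z') - D z - (D z ^ 2 + ∑ z', q z' * D z' ^ 2)) ≤
      ∑ z', q z' * Real.exp (D z' - D z - (D z ^ 2 + D z' ^ 2)) := by
    intro z
    have h := convexOn_exp.map_sum_le (t := Finset.univ) (w := q)
      (p := fun z' => D z' - D z - (D z ^ 2 + D z' ^ 2)) (fun i _ => hq i) hq1 (by simp)
    refine le_trans (le_of_eq ?_) h
    congr 1
    simp only [smul_eq_mul, mul_sub, mul_add, Finset.sum_sub_distrib, Finset.sum_add_distrib,
      ← Finset.sum_mul, hq1]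
    ring
  have symm : ∑ z, ∑ z', q z * q z' * Real.exp (D z' - D z - (D z ^ 2 + D z' ^ 2)) =
      ∑ z, ∑ z', q z * q z' * Real.exp (D z - D z' - (D z ^ 2 + D z' ^ 2)) := by
    rw [Finset.sum_comm]
    refine Finset.sum_congr rfl fun z _ => Finset.sum_congr rfl fun z' _ => ?_
    rw [mul_comm (q z'), add_comm (D z' ^ 2)]
  have pair : ∀ z z', Real.exp (D z' - D z - (D z ^ 2 + D z' ^ 2)) +
      Real.exp (D z - D z' - (D z ^ 2 + D z' ^ 2)) ≤ 2 := by
    intro z z'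
    have h := Real.cosh_le_exp_half_sq (D z' - D z)
    rw [Real.cosh_eq] at h
    have h2 : Real.exp ((D z' - D z) ^ 2 / 2) * Real.exp (-(D z ^ 2 + D z' ^ 2)) ≤ 1 := by
      rw [← Real.exp_add, Real.exp_le_one_iff]
      -- This is `(a - b) ^ 2 / 2 ≤ a ^ 2 + b ^ 2`.
      nlinarith [sq_nonneg (D z' + D z)]
    have h3 : 0 < Real.exp (-(D z ^ 2 + D z' ^ 2)) := Real.exp_pos _
    rw [sub_eq_add_neg (D z' - D z), Real.exp_add, sub_eq_add_neg (D z - D z'), Real.exp_add,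
      show D z - D z' = -(D z' - D z) by ring]
    nlinarith
  have double : ∑ z, ∑ z', q z * q z' * Real.exp (D z' - D z - (D z ^ 2 + D z' ^ 2)) ≤ 1 := by
    have h : ∑ z, ∑ z', q z * q z' * Real.exp (D z' - D z - (D z ^ 2 + D z' ^ 2)) +
        ∑ z, ∑ z', q z * q z' * Real.exp (D z - D z' - (D z ^ 2 + D z' ^ 2)) ≤
        ∑ z, ∑ z', q z * q z' * 2 := by
      simp only [← Finset.sum_add_distrib, ← mul_add]
      gcongr with z _ z' _
      · exact mul_nonneg (hq z) (hq z')
      · exact pair z z'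
    rw [← symm] at h
    have h1 : ∑ z, ∑ z', q z * q z' * 2 = 2 := by
      simp only [← Finset.sum_mul, ← Finset.mul_sum, hq1]; norm_num
    linarith
  refine le_trans (Finset.sum_le_sum fun z _ => mul_le_mul_of_nonneg_left (jensen z) (hq z)) ?_
  simpa only [Finset.mul_sum, ← mul_assoc] using double

/-! ### Maurey sparsification. -/

/-- The empirical average `r / (n + 1) * ∑ i < n, G (a i)` of `n` atoms, padded by one zero. -/
noncomputable def atomAvg {E ι : Type*} (r : ℝ) (G : ι → E → ℝ) (n : ℕ) (a : Fin n → ι) : E → ℝ :=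
  fun z => r / (n + 1) * ∑ i, G (a i) z

/-- Maurey's sparsification of a convex combination in a weighted `ℓ²` norm. -/
theorem exists_atomAvg_near {E ι : Type*} [Fintype E] [Fintype ι] {G : ι → E → ℝ}
    (hG : ∀ a z, |G a z| ≤ 1) (r : ℝ) {c : ι → ℝ} (hc : ∀ a, 0 ≤ c a) (hc1 : ∑ a, c a = 1)
    {w : E → ℝ} (hw : ∀ z, 0 ≤ w z) (n : ℕ) :
    ∃ a : Fin n → ι, ∑ z, w z * (r * ∑ i, c i * G i z - atomAvg r G n a z) ^ 2 ≤
      r ^ 2 / (n + 1) * ∑ z, w z := by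
  set h : E → ℝ := fun z => r * ∑ i, c i * G i z with hh
  have hGsq : ∀ a z, G a z ^ 2 ≤ 1 := fun a z => by
    rw [← sq_abs]; exact pow_le_one₀ (abs_nonneg _) (hG a z)
  have hmean : ∀ z, ∑ i, c i * (r * G i z) = h z := fun z => by
    simp only [hh, Finset.mul_sum]
    exact Finset.sum_congr rfl fun i _ => by ring
  -- Under the law `c` the atom `r * G i` has mean `h`, so the cross term vanishes and only a
  -- variance of at most `r ^ 2` is added.
  have hvar : ∀ e : E → ℝ, ∑ i, c i * ∑ z, w z * (e z + (h z - r * G i z)) ^ 2 ≤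
      ∑ z, w z * (e z ^ 2) + r ^ 2 * ∑ z, w z := by
    intro e
    simp only [Finset.mul_sum]
    rw [Finset.sum_comm, ← Finset.sum_add_distrib]
    refine Finset.sum_le_sum fun z _ => ?_
    have h1 : ∑ i, c i * (w z * (e z + (h z - r * G i z)) ^ 2) =
        w z * ((e z + h z) ^ 2 * ∑ i, c i - 2 * (e z + h z) * ∑ i, c i * (r * G i z) +
          r ^ 2 * ∑ i, c i * G i z ^ 2) := by
      simp only [Finset.mul_sum, ← Finset.sum_sub_distrib, ← Finset.sum_add_distrib]
      exact Finset.sum_congr rfl fun i _ => by ring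
    have h2 : ∑ i, c i * G i z ^ 2 ≤ 1 := by
      rw [← hc1]
      exact Finset.sum_le_sum fun i _ => mul_le_of_le_one_right (hc i) (hGsq i z)
    rw [h1, hc1, hmean]
    have h3 := mul_le_mul_of_nonneg_left h2 (sq_nonneg r)
    have h4 : (e z + h z) ^ 2 * 1 - 2 * (e z + h z) * h z + r ^ 2 * ∑ i, c i * G i z ^ 2 ≤
        e z ^ 2 + r ^ 2 := by nlinarith [sq_nonneg (h z)]
    calc _ ≤ w z * (e z ^ 2 + r ^ 2) := mul_le_mul_of_nonneg_left h4 (hw z)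
      _ = _ := by ring
  have hpick : ∀ e : E → ℝ, ∃ i, ∑ z, w z * (e z + (h z - r * G i z)) ^ 2 ≤
      ∑ z, w z * (e z ^ 2) + r ^ 2 * ∑ z, w z := by
    intro e
    by_contra! hcon
    have hlt : (∑ z, w z * (e z ^ 2) + r ^ 2 * ∑ z, w z) * ∑ i, c i <
        ∑ i, c i * ∑ z, w z * (e z + (h z - r * G i z)) ^ 2 := by
      rw [Finset.mul_sum]
      obtain ⟨i, -, hi⟩ := Finset.exists_ne_zero_of_sum_ne_zero (hc1.trans_ne one_ne_zero)
      refine Finset.sum_lt_sum (fun i _ => ?_) ⟨i, Finset.mem_univ _, ?_⟩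
      · rw [mul_comm]; exact mul_le_mul_of_nonneg_left (hcon i).le (hc i)
      · rw [mul_comm]
        exact mul_lt_mul_of_pos_left (hcon i) (lt_of_le_of_ne (hc i) hi.symm)
    rw [hc1, mul_one] at hlt
    exact absurd (hvar e) (not_le.2 hlt)
  -- Derandomised Maurey: some atom does no worse than the average. The zero atom of the padding
  -- accounts for the base case `h ^ 2 ≤ r ^ 2`.
  have greedy : ∀ n : ℕ, ∃ a : Fin n → ι,
      ∑ z, w z * ((n + 1) * h z - r * ∑ i, G (a i) z) ^ 2 ≤ (n + 1) * (r ^ 2 * ∑ z, w z) := by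
    intro n
    induction n with
    | zero =>
      refine ⟨Fin.elim0, ?_⟩
      simp only [Finset.univ_eq_empty, Finset.sum_empty, Nat.cast_zero]
      have hbound : ∀ z, h z ^ 2 ≤ r ^ 2 := fun z => by
        have habs : |∑ i, c i * G i z| ≤ 1 := by
          refine (Finset.abs_sum_le_sum_abs _ _).trans ?_
          rw [← hc1]
          refine Finset.sum_le_sum fun i _ => ?_
          rw [abs_mul, abs_of_nonneg (hc i)]
          exact mul_le_of_le_one_right (hc i) (hG i z)
        rw [hh, mul_pow]
        refine mul_le_of_le_one_right (sq_nonneg r) ?_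
        rw [← sq_abs]; exact pow_le_one₀ (abs_nonneg _) habs
      simp only [zero_add, one_mul, mul_zero, sub_zero]
      rw [Finset.mul_sum]
      refine Finset.sum_le_sum fun z _ => ?_
      rw [mul_comm (r ^ 2)]
      exact mul_le_mul_of_nonneg_left (hbound z) (hw z)
    | succ n ih =>
      obtain ⟨a, ha⟩ := ih
      obtain ⟨i, hi⟩ := hpick fun z => (n + 1) * h z - r * ∑ i, G (a i) z
      refine ⟨Fin.cons i a, ?_⟩
      have hrew : ∀ z, ((n + 1 : ℕ) + 1 : ℝ) * h z -
          r * ∑ l, G ((Fin.cons i a : Fin (n + 1) → ι) l) z =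
          (n + 1) * h z - r * ∑ i, G (a i) z + (h z - r * G i z) := fun z => by
        rw [Fin.sum_univ_succ]
        simp only [Fin.cons_zero, Fin.cons_succ, Nat.cast_succ]
        ring
      simp only [hrew]
      push_cast
      linarith
  obtain ⟨a, ha⟩ := greedy n
  refine ⟨a, ?_⟩
  have hn : (0 : ℝ) < n + 1 := by positivity
  have hrew : ∑ z, w z * (h z - atomAvg r G n a z) ^ 2 =
      (∑ z, w z * ((n + 1) * h z - r * ∑ i, G (a i) z) ^ 2) / (n + 1) ^ 2 := by
    rw [Finset.sum_div]
    refine Finset.sum_congr rfl fun z _ => ?_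
    simp only [atomAvg]
    field_simp
  rw [hrew, div_le_iff₀ (by positivity)]
  refine ha.trans (le_of_eq ?_)
  field_simp

/-! ### Predictive probabilities and the exponential supermartingale. -/

section Predictive

variable {Ω E : Type*} {T : ℕ}

theorem strictPast_le [MeasurableSpace Ω] [MeasurableSpace E] {Z : Fin T → Ω → E} (hZ : ∀ t, Measurable (Z t)) (t : Fin T) :
    strictPast Z t ≤ (inferInstance : MeasurableSpace Ω) :=
  iSup₂_le fun s _ => (hZ s).comap_le

theorem strictPast_mono [MeasurableSpace E] (Z : Fin T → Ω → E) {s t : Fin T} (h : s ≤ t) :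
    strictPast Z s ≤ strictPast Z t :=
  iSup₂_le fun i hi => le_iSup₂_of_le i (hi.trans_le h) le_rfl

theorem measurable_strictPast [MeasurableSpace E] (Z : Fin T → Ω → E) {s t : Fin T} (h : s < t) :
    Measurable[strictPast Z t] (Z s) :=
  Measurable.mono (comap_measurable (Z s)) (le_iSup₂_of_le s h le_rfl) le_rfl

variable [MeasurableSpace Ω] [MeasurableSpace E] [DecidableEq E]

/-- The conditional probability that `Z t = z` given the strict past of the process. -/
noncomputable def predProb (μ : Measure Ω) (Z : Fin T → Ω → E) (t : Fin T) (z : E) : Ω → ℝ :=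
  μ[fun ω => if Z t ω = z then 1 else 0 | strictPast Z t]

theorem measurable_predProb (μ : Measure Ω) (Z : Fin T → Ω → E) (t : Fin T) (z : E) :
    Measurable[strictPast Z t] (predProb μ Z t z) :=
  stronglyMeasurable_condExp.measurable

variable [Fintype E]

/-- The martingale of the differences between the predicted and observed values of `D`. -/
noncomputable def predGap (μ : Measure Ω) (Z : Fin T → Ω → E) (D : E → ℝ) (ω : Ω) : ℝ :=
  ∑ t, (∑ z, predProb μ Z t z ω * D z - D (Z t ω))

/-- The sum of the observed and predictable quadratic variations of `D`. -/
noncomputable def predQuad (μ : Measure Ω) (Z : Fin T → Ω → E) (D : E → ℝ) (ω : Ω) : ℝ :=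
  ∑ t, (D (Z t ω) ^ 2 + ∑ z, predProb μ Z t z ω * D z ^ 2)

/-- The multiplicative increment of the exponential supermartingale, with the observed value
replaced by a free variable. -/
noncomputable def expIncr (μ : Measure Ω) (Z : Fin T → Ω → E) (D : E → ℝ) (t : Fin T) (ω : Ω)
    (z : E) : ℝ :=
  Real.exp ((∑ z', predProb μ Z t z' ω * D z') - D z -
    (D z ^ 2 + ∑ z', predProb μ Z t z' ω * D z' ^ 2))

theorem measurable_expIncr (μ : Measure Ω) (Z : Fin T → Ω → E) (D : E → ℝ) (t : Fin T) (z : E) :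
    Measurable[strictPast Z t] fun ω => expIncr μ Z D t ω z := by
  have h : ∀ f : E → ℝ, Measurable[strictPast Z t] fun ω => ∑ z', predProb μ Z t z' ω * f z' :=
    fun f => Finset.measurable_sum _ fun z' _ => (measurable_predProb μ Z t z').mul_const _
  exact (((h D).sub_const _).sub ((h _).const_add _)).exp

/-- Both `x - x ^ 2` and `-x - x ^ 2` are at most `1 / 4`. The bound, uniform in `D`, supplies
integrability of the products. -/
theorem expIncr_le {μ : Measure Ω} {Z : Fin T → Ω → E} {t : Fin T} {ω : Ω}
    (h : (∀ z, 0 ≤ predProb μ Z t z ω) ∧ ∑ z, predProb μ Z t z ω = 1) (D : E → ℝ) (z : E) :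
    expIncr μ Z D t ω z ≤ Real.exp (1 / 2) := by
  refine Real.exp_le_exp.2 ?_
  have h1 : (∑ z', predProb μ Z t z' ω * D z') - ∑ z', predProb μ Z t z' ω * D z' ^ 2 ≤ 1 / 4 := by
    have h2 : ∑ z', predProb μ Z t z' ω * (D z' - D z' ^ 2) ≤
        ∑ z', predProb μ Z t z' ω * (1 / 4) := by
      gcongr with z' _
      · exact h.1 z'
      · nlinarith [sq_nonneg (D z' - 1 / 2)]
    rw [← Finset.sum_mul, h.2] at h2
    simp only [mul_sub, Finset.sum_sub_distrib] at h2
    linarith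
  nlinarith [sq_nonneg (D z + 1 / 2)]

variable [MeasurableSingletonClass E]

theorem integrable_ite_eq {μ : Measure Ω} [IsFiniteMeasure μ] {Z : Fin T → Ω → E}
    (hZ : ∀ t, Measurable (Z t)) (t : Fin T) (z : E) :
    Integrable (fun ω => if Z t ω = z then (1 : ℝ) else 0) μ := by
  refine Integrable.of_bound (C := 1) ?_ ?_
  · exact ((Measurable.of_discrete (f := fun e : E => if e = z then (1 : ℝ) else 0)).comp
      (hZ t)).aestronglyMeasurable
  · refine Filter.Eventually.of_forall fun ω => ?_
    split_ifs <;> simp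

theorem ae_condExp_comp_eq_sum_predProb {μ : Measure Ω} [IsFiniteMeasure μ]
    {Z : Fin T → Ω → E} (hZ : ∀ t, Measurable (Z t)) (t : Fin T) (f : E → ℝ) :
    μ[fun ω => f (Z t ω) | strictPast Z t] =ᵐ[μ] fun ω => ∑ z, predProb μ Z t z ω * f z := by
  have hdecomp : (fun ω => f (Z t ω)) =
      ∑ z, f z • fun ω => if Z t ω = z then (1 : ℝ) else 0 := by
    ext ω
    simp [Finset.sum_apply]
  rw [hdecomp]
  refine (condExp_finsetSum (fun z _ => (integrable_ite_eq hZ t z).smul (f z)) _).trans ?_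
  have hsmul : ∀ᵐ ω ∂μ, ∀ z, (μ[f z • fun ω => if Z t ω = z then (1 : ℝ) else 0 |
      strictPast Z t]) ω = f z * predProb μ Z t z ω :=
    ae_all_iff.2 fun z => (condExp_smul (f z) _ _).mono fun ω hω => by
      rw [hω]; simp [predProb]
  filter_upwards [hsmul] with ω hω
  rw [Finset.sum_apply]
  exact Finset.sum_congr rfl fun z _ => by rw [hω, mul_comm]

theorem ae_predProb {μ : Measure Ω} [IsFiniteMeasure μ] {Z : Fin T → Ω → E}
    (hZ : ∀ t, Measurable (Z t)) :
    ∀ᵐ ω ∂μ, ∀ t, (∀ z, 0 ≤ predProb μ Z t z ω) ∧ ∑ z, predProb μ Z t z ω = 1 := by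
  refine ae_all_iff.2 fun t => ?_
  have hnonneg : ∀ᵐ ω ∂μ, ∀ z, 0 ≤ predProb μ Z t z ω :=
    ae_all_iff.2 fun z => condExp_nonneg <| Filter.Eventually.of_forall fun ω => by
      simp only [Pi.zero_apply]; split_ifs <;> simp
  have hsum := ae_condExp_comp_eq_sum_predProb (μ := μ) hZ t fun _ => 1
  rw [condExp_const (strictPast_le hZ t)] at hsum
  filter_upwards [hnonneg, hsum] with ω h1 h2
  exact ⟨h1, by simpa using h2.symm⟩

/-- Almost surely the conditional expectations of all functions of `Z t` are given by the
predictive probabilities simultaneously, because the past generates a finite sigma-algebra. -/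
theorem ae_forall_condExp_comp_eq {μ : Measure Ω} [IsFiniteMeasure μ] {Z : Fin T → Ω → E}
    (hZ : ∀ t, Measurable (Z t)) :
    ∀ᵐ ω ∂μ, ∀ t, ∀ f : E → ℝ, (μ[fun ω => f (Z t ω) | strictPast Z t]) ω =
      ∑ z, predProb μ Z t z ω * f z := by
  refine ae_all_iff.2 fun t => ?_
  let H : Ω → ({s : Fin T // s < t} → E) := fun ω s => Z s ω
  have hH : strictPast Z t = MeasurableSpace.comap H inferInstance := by
    simp only [strictPast, MeasurableSpace.pi, MeasurableSpace.comap_iSup,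
      MeasurableSpace.comap_comp, iSup_subtype]
    rfl
  -- There are finitely many histories, so those of measure zero can be discarded together.
  have hatom : ∀ᵐ ω ∂μ, μ (H ⁻¹' {H ω}) ≠ 0 := by
    have hsub : {ω | ¬ μ (H ⁻¹' {H ω}) ≠ 0} ⊆
        ⋃ h ∈ {h | μ (H ⁻¹' {h}) = 0}, H ⁻¹' {h} := by
      intro ω hω
      simp only [Set.mem_iUnion]
      exact ⟨H ω, not_not.1 hω, rfl⟩
    refine measure_mono_null hsub ?_
    exact (measure_biUnion_null_iff (Set.toFinite _).countable).2 fun h hh => hh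
  filter_upwards [hatom] with ω hω f
  by_contra hne
  -- The set of equality is a union of atoms of the past. A failure at `ω` would therefore spread
  -- over its whole atom, which has positive measure.
  have hmeas : MeasurableSet[strictPast Z t] {ω | (μ[fun ω => f (Z t ω) | strictPast Z t]) ω =
      ∑ z, predProb μ Z t z ω * f z} := by
    refine @measurableSet_eq_fun _ _ (strictPast Z t) _ _ _ _
      stronglyMeasurable_condExp.measurable ?_
    exact Finset.measurable_sum _ fun z _ => (measurable_predProb μ Z t z).mul_const _
  rw [hH] at hmeas
  obtain ⟨S, -, hS⟩ := hmeas
  rw [← hH] at hS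
  refine hω (measure_mono_null ?_ (ae_condExp_comp_eq_sum_predProb (μ := μ) hZ t f))
  intro ω' hω' hmem
  refine hne ?_
  change ω' ∈ {ω | (μ[fun ω => f (Z t ω) | strictPast Z t]) ω =
      ∑ z, predProb μ Z t z ω * f z} at hmem
  change ω ∈ {ω | (μ[fun ω => f (Z t ω) | strictPast Z t]) ω =
      ∑ z, predProb μ Z t z ω * f z}
  rw [← hS] at hmem ⊢
  rw [Set.mem_preimage] at hmem ⊢
  rwa [← show H ω' = H ω from hω']

/-- The supermartingale step: splitting over the values of `Z t` leaves factors known from the past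
times indicators. Conditioning turns the indicators into predictive probabilities, and
`sum_mul_exp_centered_le_one` applies pointwise. -/
theorem integral_mul_expIncr_le {μ : Measure Ω} [IsFiniteMeasure μ] {Z : Fin T → Ω → E}
    (hZ : ∀ t, Measurable (Z t)) (D : E → ℝ) (t : Fin T) {P : Ω → ℝ}
    (hP : Measurable[strictPast Z t] P) (hP0 : ∀ ω, 0 ≤ P ω) {c : ℝ} (hPc : ∀ᵐ ω ∂μ, P ω ≤ c) :
    ∫ ω, P ω * expIncr μ Z D t ω (Z t ω) ∂μ ≤ ∫ ω, P ω ∂μ := by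
  have hm := strictPast_le hZ t
  let g : E → Ω → ℝ := fun z ω => P ω * expIncr μ Z D t ω z
  have hg : ∀ z, StronglyMeasurable[strictPast Z t] (g z) := fun z =>
    (hP.mul (measurable_expIncr μ Z D t z)).stronglyMeasurable
  have hgc : ∀ z, ∀ᵐ ω ∂μ, ‖g z ω‖ ≤ c * Real.exp (1 / 2) := fun z => by
    filter_upwards [hPc, ae_predProb hZ] with ω h1 h2
    have hexp : 0 ≤ expIncr μ Z D t ω z := Real.exp_nonneg _
    rw [Real.norm_of_nonneg (mul_nonneg (hP0 ω) hexp)]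
    exact mul_le_mul h1 (expIncr_le (h2 t) D z) hexp ((hP0 ω).trans h1)
  have hgint : ∀ z, Integrable (g z) μ := fun z =>
    Integrable.of_bound ((hg z).mono hm).aestronglyMeasurable _ (hgc z)
  have hpull : ∀ z, ∫ ω, g z ω * (if Z t ω = z then (1 : ℝ) else 0) ∂μ =
      ∫ ω, g z ω * predProb μ Z t z ω ∂μ := fun z => by
    rw [← integral_condExp hm]
    exact integral_congr_ae (condExp_stronglyMeasurable_mul_of_bound hm (hg z)
      (integrable_ite_eq hZ t z) _ (hgc z))
  have hint1 : ∀ z, Integrable (fun ω => g z ω * (if Z t ω = z then (1 : ℝ) else 0)) μ := fun z =>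
    (integrable_ite_eq hZ t z).bdd_mul ((hg z).mono hm).aestronglyMeasurable (hgc z)
  have hint2 : ∀ z, Integrable (fun ω => g z ω * predProb μ Z t z ω) μ := fun z =>
    integrable_condExp.bdd_mul ((hg z).mono hm).aestronglyMeasurable (hgc z)
  calc ∫ ω, P ω * expIncr μ Z D t ω (Z t ω) ∂μ
      = ∫ ω, ∑ z, g z ω * (if Z t ω = z then (1 : ℝ) else 0) ∂μ := by simp [g]
    _ = ∫ ω, ∑ z, g z ω * predProb μ Z t z ω ∂μ := by
        rw [integral_finsetSum _ fun z _ => hint1 z, integral_finsetSum _ fun z _ => hint2 z]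
        exact Finset.sum_congr rfl fun z _ => hpull z
    _ ≤ ∫ ω, P ω ∂μ := by
        refine integral_mono_ae (integrable_finsetSum _ fun z _ => hint2 z) ?_ ?_
        · refine Integrable.of_bound (hP.mono hm le_rfl).aestronglyMeasurable c ?_
          filter_upwards [hPc] with ω hω
          rwa [Real.norm_of_nonneg (hP0 ω)]
        · filter_upwards [ae_predProb hZ] with ω hω
          have h := sum_mul_exp_centered_le_one (hω t).1 (hω t).2 D
          have h2 : ∑ z, g z ω * predProb μ Z t z ω =
              P ω * ∑ z, predProb μ Z t z ω * expIncr μ Z D t ω z := by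
            rw [Finset.mul_sum]
            exact Finset.sum_congr rfl fun z _ => by simp only [g]; ring
          rw [h2]
          exact mul_le_of_le_one_right (hP0 ω) h

theorem integrable_and_integral_prod_expIncr_le {μ : Measure Ω} [IsProbabilityMeasure μ]
    {Z : Fin T → Ω → E} (hZ : ∀ t, Measurable (Z t)) (D : E → ℝ) :
    Integrable (fun ω => ∏ t, expIncr μ Z D t ω (Z t ω)) μ ∧
      ∫ ω, ∏ t, expIncr μ Z D t ω (Z t ω) ∂μ ≤ 1 := by
  -- Padding by `1` beyond `T` allows induction over prefixes indexed by natural numbers.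
  let F : ℕ → Ω → ℝ := fun i ω => if h : i < T then expIncr μ Z D ⟨i, h⟩ ω (Z ⟨i, h⟩ ω) else 1
  have hF0 : ∀ n ω, 0 ≤ ∏ i ∈ Finset.range n, F i ω := fun n ω => by
    refine Finset.prod_nonneg fun i _ => ?_
    simp only [F]
    split_ifs
    · exact Real.exp_nonneg _
    · exact zero_le_one
  have hFc : ∀ n, ∀ᵐ ω ∂μ, ∏ i ∈ Finset.range n, F i ω ≤ Real.exp (1 / 2) ^ n := fun n => by
    filter_upwards [ae_predProb hZ] with ω hω
    have hfactor : ∀ i ∈ Finset.range n, F i ω ≤ Real.exp (1 / 2) := by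
      intro i _
      simp only [F]
      split_ifs
      · exact expIncr_le (hω _) D _
      · exact Real.one_le_exp (by norm_num)
    refine (Finset.prod_le_prod (fun i _ => ?_) hfactor).trans_eq (by simp)
    simp only [F]
    split_ifs
    · exact Real.exp_nonneg _
    · exact zero_le_one
  have hexpand : ∀ (s : Fin T) (ω : Ω), expIncr μ Z D s ω (Z s ω) =
      ∑ z, expIncr μ Z D s ω z * if Z s ω = z then 1 else 0 := fun s ω => by simp
  have hmeas_of_lt : ∀ s t : Fin T, s < t →
      Measurable[strictPast Z t] fun ω => expIncr μ Z D s ω (Z s ω) := by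
    intro s t hst
    simp only [hexpand]
    refine Finset.measurable_sum _ fun z _ => ?_
    refine ((measurable_expIncr μ Z D s z).mono (strictPast_mono Z hst.le) le_rfl).mul ?_
    exact (Measurable.of_discrete (f := fun e : E => if e = z then (1 : ℝ) else 0)).comp
      (measurable_strictPast Z hst)
  have hmeas : ∀ s : Fin T, Measurable fun ω => expIncr μ Z D s ω (Z s ω) := by
    intro s
    simp only [hexpand]
    refine Finset.measurable_sum _ fun z _ => ?_
    refine ((measurable_expIncr μ Z D s z).mono (strictPast_le hZ s) le_rfl).mul ?_
    exact (Measurable.of_discrete (f := fun e : E => if e = z then (1 : ℝ) else 0)).comp (hZ s)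
  have hstep : ∀ n ≤ T, ∫ ω, ∏ i ∈ Finset.range n, F i ω ∂μ ≤ 1 := by
    intro n hn
    induction n with
    | zero => simp
    | succ n ih =>
      refine le_trans ?_ (ih (Nat.le_of_succ_le hn))
      simp only [Finset.prod_range_succ]
      have hFn : ∀ ω, F n ω = expIncr μ Z D ⟨n, hn⟩ ω (Z ⟨n, hn⟩ ω) := fun ω => dif_pos hn
      simp only [hFn]
      refine integral_mul_expIncr_le hZ D ⟨n, hn⟩ ?_ (hF0 n) (hFc n)
      refine Finset.measurable_prod _ fun i hi => ?_
      have hin : i < n := Finset.mem_range.1 hi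
      simp only [F, dif_pos (hin.trans hn)]
      exact hmeas_of_lt _ _ hin
  have hprod : ∀ ω, ∏ t, expIncr μ Z D t ω (Z t ω) = ∏ i ∈ Finset.range T, F i ω := fun ω => by
    rw [Finset.prod_range]
    exact Finset.prod_congr rfl fun t _ => by simp [F]
  refine ⟨Integrable.of_bound (C := Real.exp (1 / 2) ^ T)
    (Finset.measurable_prod _ fun t _ => hmeas t).aestronglyMeasurable ?_, ?_⟩
  · filter_upwards [hFc T] with ω hω
    rw [hprod, Real.norm_of_nonneg (hF0 T ω)]
    exact hω
  · simp only [hprod]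
    exact hstep T le_rfl

/-- A self-normalised exponential tail bound. -/
theorem measureReal_predGap_sub_predQuad_ge_le {μ : Measure Ω} [IsProbabilityMeasure μ]
    {Z : Fin T → Ω → E} (hZ : ∀ t, Measurable (Z t)) (D : E → ℝ) (A : ℝ) :
    μ.real {ω | A ≤ predGap μ Z D ω - predQuad μ Z D ω} ≤ Real.exp (-A) := by
  have hprod : ∀ ω, ∏ t, expIncr μ Z D t ω (Z t ω) =
      Real.exp (1 * (predGap μ Z D ω - predQuad μ Z D ω)) := fun ω => by
    simp only [expIncr]
    rw [← Real.exp_sum, one_mul, predGap, predQuad, Finset.sum_sub_distrib]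
  obtain ⟨hint, hle⟩ := integrable_and_integral_prod_expIncr_le (μ := μ) hZ D
  simp only [hprod] at hint hle
  -- Chernoff with parameter `1`; rescaling `D` later plays the role of optimising the parameter.
  refine (ProbabilityTheory.measure_ge_le_exp_mul_mgf A zero_le_one hint).trans ?_
  rw [neg_one_mul]
  exact mul_le_of_le_one_right (Real.exp_nonneg _) hle

end Predictive

/-! ### Deterministic chaining. -/

/-- Deterministic chaining along the Maurey approximations with `2 ^ j - 1` atoms. -/
theorem chaining_atomAvg {E ι : Type*} [Fintype E] [Fintype ι] {G : ι → E → ℝ}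
    (hG : ∀ a z, |G a z| ≤ 1) {r : ℝ} (hr : 0 ≤ r) {φ : ℝ → ℝ} {K : ℝ}
    (hφ : ∀ x y, |φ x - φ y| ≤ K * |x - y|) {v w : E → ℝ} (hvw : ∀ z, |v z| ≤ w z)
    (hv : ∑ z, v z = 0) (J : ℕ) {η B : ℕ → ℝ} (hη : ∀ j, 0 ≤ η j)
    (hlink : ∀ j < J, ∀ (a : Fin (2 ^ j - 1) → ι) (b : Fin (2 ^ (j + 1) - 1) → ι),
      ∑ z, v z * (φ (atomAvg r G _ b z) - φ (atomAvg r G _ a z)) ≤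
        η j * ∑ z, w z * (φ (atomAvg r G _ b z) - φ (atomAvg r G _ a z)) ^ 2 + B j)
    {c : ι → ℝ} (hc : ∀ a, 0 ≤ c a) (hc1 : ∑ a, c a = 1) :
    ∑ z, v z * φ (r * ∑ i, c i * G i z) ≤
      ∑ j ∈ Finset.range J, (η j * (3 * K ^ 2 * r ^ 2 * (∑ z, w z) / 2 ^ j) + B j) +
        K * r * (∑ z, w z) / Real.sqrt (2 ^ J) := by
  have hw : ∀ z, 0 ≤ w z := fun z => (abs_nonneg _).trans (hvw z)
  have hK : 0 ≤ K := by simpa using (abs_nonneg _).trans (hφ 1 0)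
  set W := ∑ z, w z with hWdef
  have hW : 0 ≤ W := Finset.sum_nonneg fun z _ => hw z
  set h : E → ℝ := fun z => r * ∑ i, c i * G i z with hh
  have hpow : ∀ j : ℕ, ((2 ^ j - 1 : ℕ) : ℝ) + 1 = 2 ^ j := fun j => by
    rw [Nat.cast_sub Nat.one_le_two_pow]; push_cast; ring
  have happrox : ∀ j : ℕ, ∃ a : Fin (2 ^ j - 1) → ι,
      ∑ z, w z * (h z - atomAvg r G _ a z) ^ 2 ≤ r ^ 2 / 2 ^ j * W := fun j => by
    obtain ⟨a, ha⟩ := exists_atomAvg_near hG r hc hc1 hw (2 ^ j - 1)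
    exact ⟨a, by rwa [hpow] at ha⟩
  choose a ha using happrox
  -- Level `0` has no atoms, so `φ` is the constant `φ 0` there, which `v` annihilates.
  have hstart : ∑ z, v z * φ (atomAvg r G _ (a 0) z) = 0 := by
    have h0 : ∀ z, atomAvg r G _ (a 0) z = 0 := fun z => by simp [atomAvg]
    simp only [h0, ← Finset.sum_mul, hv, zero_mul]
  have hend : ∑ z, v z * φ (h z) - ∑ z, v z * φ (atomAvg r G _ (a J) z) ≤
      K * r * W / Real.sqrt (2 ^ J) := by
    have h1 : ∑ z, v z * φ (h z) - ∑ z, v z * φ (atomAvg r G _ (a J) z) ≤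
        K * ∑ z, w z * |h z - atomAvg r G _ (a J) z| := by
      rw [← Finset.sum_sub_distrib, Finset.mul_sum]
      refine Finset.sum_le_sum fun z _ => ?_
      rw [← mul_sub]
      calc _ ≤ |v z * (φ (h z) - φ (atomAvg r G _ (a J) z))| := le_abs_self _
        _ = |v z| * |φ (h z) - φ (atomAvg r G _ (a J) z)| := abs_mul _ _
        _ ≤ w z * (K * |h z - atomAvg r G _ (a J) z|) :=
          mul_le_mul (hvw z) (hφ _ _) (abs_nonneg _) (hw z)
        _ = _ := by ring
    have h2 : (∑ z, w z * |h z - atomAvg r G _ (a J) z|) ^ 2 ≤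
        W * ∑ z, w z * (h z - atomAvg r G _ (a J) z) ^ 2 := by
      refine Finset.sum_sq_le_sum_mul_sum_of_sq_le_mul _ (fun z _ => hw z)
        (fun z _ => mul_nonneg (hw z) (sq_nonneg _)) fun z _ => ?_
      rw [mul_pow, sq_abs]; exact le_of_eq (by ring)
    have h3 : ∑ z, w z * |h z - atomAvg r G _ (a J) z| ≤ r * W / Real.sqrt (2 ^ J) := by
      refine le_of_sq_le_sq ?_ (by positivity)
      rw [div_pow, Real.sq_sqrt (by positivity)]
      refine (h2.trans (mul_le_mul_of_nonneg_left (ha J) hW)).trans (le_of_eq ?_)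
      ring
    calc _ ≤ _ := h1
      _ ≤ K * (r * W / Real.sqrt (2 ^ J)) := mul_le_mul_of_nonneg_left h3 hK
      _ = _ := by ring
  -- Each link passes through `h`; the constant `3` is `2 * (1 + 1 / 2)`, from the errors at levels
  -- `j` and `j + 1`.
  have hlinks : ∀ j < J, ∑ z, v z * φ (atomAvg r G _ (a (j + 1)) z) -
      ∑ z, v z * φ (atomAvg r G _ (a j) z) ≤ η j * (3 * K ^ 2 * r ^ 2 * W / 2 ^ j) + B j := by
    intro j hj
    rw [← Finset.sum_sub_distrib]
    simp only [← mul_sub]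
    refine (hlink j hj (a j) (a (j + 1))).trans ?_
    gcongr
    · exact hη j
    have hpt : ∀ z, w z * (φ (atomAvg r G _ (a (j + 1)) z) - φ (atomAvg r G _ (a j) z)) ^ 2 ≤
        2 * K ^ 2 * (w z * (h z - atomAvg r G _ (a (j + 1)) z) ^ 2) +
          2 * K ^ 2 * (w z * (h z - atomAvg r G _ (a j) z) ^ 2) := by
      intro z
      set x := atomAvg r G _ (a (j + 1)) z
      set y := atomAvg r G _ (a j) z
      have h1 : (φ x - φ y) ^ 2 ≤ K ^ 2 * (x - y) ^ 2 := by
        rw [← sq_abs, ← sq_abs (x - y), ← mul_pow]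
        exact pow_le_pow_left₀ (abs_nonneg _) (hφ x y) 2
      have h2 : (x - y) ^ 2 ≤ 2 * (h z - x) ^ 2 + 2 * (h z - y) ^ 2 := by
        nlinarith [sq_nonneg ((h z - x) + (h z - y))]
      have h3 : (φ x - φ y) ^ 2 ≤ K ^ 2 * (2 * (h z - x) ^ 2 + 2 * (h z - y) ^ 2) :=
        h1.trans (mul_le_mul_of_nonneg_left h2 (sq_nonneg K))
      calc _ ≤ w z * (K ^ 2 * (2 * (h z - x) ^ 2 + 2 * (h z - y) ^ 2)) :=
            mul_le_mul_of_nonneg_left h3 (hw z)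
        _ = _ := by ring
    refine (Finset.sum_le_sum fun z _ => hpt z).trans ?_
    rw [Finset.sum_add_distrib, ← Finset.mul_sum, ← Finset.mul_sum]
    have hK2 : (0 : ℝ) ≤ 2 * K ^ 2 := by positivity
    refine (add_le_add (mul_le_mul_of_nonneg_left (ha (j + 1)) hK2)
      (mul_le_mul_of_nonneg_left (ha j) hK2)).trans (le_of_eq ?_)
    rw [pow_succ]
    field_simp
    ring
  have htel := Finset.sum_range_sub (fun j => ∑ z, v z * φ (atomAvg r G _ (a j) z)) J
  have hsum := Finset.sum_le_sum fun j hj => hlinks j (Finset.mem_range.1 hj)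
  rw [htel, hstart] at hsum
  linarith

/-! ### The uniform bound over a scaled convex hull. -/

section Predictive

variable {Ω E : Type*} [MeasurableSpace Ω] [MeasurableSpace E] [DecidableEq E] [Fintype E] {T : ℕ}

/-- The total observed and predicted mass of `z` along the process. -/
noncomputable def predMass (μ : Measure Ω) (Z : Fin T → Ω → E) (ω : Ω) (z : E) : ℝ :=
  ∑ t, ((if Z t ω = z then 1 else 0) + predProb μ Z t z ω)

/-- The difference between the predicted and observed masses of `z` along the process. -/
noncomputable def predDiff (μ : Measure Ω) (Z : Fin T → Ω → E) (ω : Ω) (z : E) : ℝ :=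
  ∑ t, (predProb μ Z t z ω - if Z t ω = z then 1 else 0)

/-- Grouping by value instead of time gives the linear form in `D` that `chaining_atomAvg` takes as
input. -/
theorem predGap_eq_sum (μ : Measure Ω) (Z : Fin T → Ω → E) (D : E → ℝ) (ω : Ω) :
    predGap μ Z D ω = ∑ z, predDiff μ Z ω z * D z := by
  simp only [predGap, predDiff, Finset.sum_mul]
  rw [Finset.sum_comm]
  refine Finset.sum_congr rfl fun t _ => ?_
  simp [sub_mul, Finset.sum_sub_distrib]

theorem predQuad_eq_sum (μ : Measure Ω) (Z : Fin T → Ω → E) (D : E → ℝ) (ω : Ω) :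
    predQuad μ Z D ω = ∑ z, predMass μ Z ω z * D z ^ 2 := by
  simp only [predQuad, predMass, Finset.sum_mul]
  rw [Finset.sum_comm (s := Finset.univ (α := E))]
  refine Finset.sum_congr rfl fun t _ => ?_
  simp [add_mul, Finset.sum_add_distrib]

/-- The predictive law of the loss `φ` deviates from the empirical one by at most a chaining sum,
uniformly over the scaled convex hull of finitely many bounded functions. -/
theorem exists_uniform_predGap_le [MeasurableSingletonClass E] {ι : Type*} [Fintype ι] [Nonempty ι]
    {μ : Measure Ω} [IsProbabilityMeasure μ] {Z : Fin T → Ω → E} (hZ : ∀ t, Measurable (Z t))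
    (hT : 0 < T) {G : ι → E → ℝ} (hG : ∀ a z, |G a z| ≤ 1) {r : ℝ} (hr : 0 < r) {φ : ℝ → ℝ}
    {K : ℝ} (hK : 0 < K) (hφ : ∀ x y, |φ x - φ y| ≤ K * |x - y|) (J : ℕ) {L : ℝ} (hL : 0 ≤ L) :
    ∃ bad : Set Ω, μ.real bad ≤ Real.exp (-L) ∧ ∀ ω ∉ bad,
      ((∀ t, (∀ z, 0 ≤ predProb μ Z t z ω) ∧ ∑ z, predProb μ Z t z ω = 1) →
      ∀ c : ι → ℝ, (∀ a, 0 ≤ c a) → ∑ a, c a = 1 →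
        predGap μ Z (fun z => φ (r * ∑ i, c i * G i z)) ω ≤
          ∑ j ∈ Finset.range J, 2 * Real.sqrt (6 * K ^ 2 * r ^ 2 * T / 2 ^ j *
            (3 * 2 ^ j * Real.log (Fintype.card ι) + (j + 1) + L)) +
          2 * K * r * T / Real.sqrt (2 ^ J)) := by
  set N : ℝ := (Fintype.card ι : ℝ) with hN
  have hN1 : 1 ≤ N := Nat.one_le_cast.2 (Nat.succ_le_of_lt Fintype.card_pos)
  have hlogN : 0 ≤ Real.log N := Real.log_nonneg hN1
  have hTpos : (0 : ℝ) < T := by exact_mod_cast hT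
  let R : ℕ → ℝ := fun j => 6 * K ^ 2 * r ^ 2 * T / 2 ^ j
  -- The three terms pay for the number of links at level `j`, for summing over the levels, and for
  -- the confidence.
  let A : ℕ → ℝ := fun j => 3 * 2 ^ j * Real.log N + (j + 1) + L
  have hR : ∀ j, 0 < R j := fun j => by positivity
  have hA : ∀ j, 0 < A j := fun j => by positivity
  -- This scale minimises `η * R + A / η`, with value `2 * √(R * A)`.
  let η : ℕ → ℝ := fun j => Real.sqrt (A j / R j)
  have hη : ∀ j, 0 < η j := fun j => Real.sqrt_pos.2 (div_pos (hA j) (hR j))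
  let D : (j : ℕ) → (Fin (2 ^ j - 1) → ι) × (Fin (2 ^ (j + 1) - 1) → ι) → E → ℝ :=
    fun j ab z => φ (atomAvg r G _ ab.2 z) - φ (atomAvg r G _ ab.1 z)
  let bad : Set Ω := ⋃ j ∈ Finset.range J, ⋃ ab ∈ (Finset.univ : Finset
    ((Fin (2 ^ j - 1) → ι) × (Fin (2 ^ (j + 1) - 1) → ι))),
    {ω | A j ≤ predGap μ Z (fun z => η j * D j ab z) ω - predQuad μ Z (fun z => η j * D j ab z) ω}
  refine ⟨bad, ?_, ?_⟩
  · have hlevel : ∀ j, ∑ _ab : (Fin (2 ^ j - 1) → ι) × (Fin (2 ^ (j + 1) - 1) → ι),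
        Real.exp (-A j) ≤ Real.exp (-L) * (1 / 2 / 2 ^ j) := by
      intro j
      rw [Finset.sum_const, nsmul_eq_mul, Finset.card_univ, Fintype.card_prod]
      simp only [Fintype.card_fun, Fintype.card_fin]
      push_cast
      rw [← hN, ← pow_add]
      have h1 : N ^ (2 ^ j - 1 + (2 ^ (j + 1) - 1)) ≤ Real.exp (3 * 2 ^ j * Real.log N) := by
        calc _ ≤ N ^ (3 * 2 ^ j) := pow_le_pow_right₀ hN1 (by rw [pow_succ]; omega)
          _ = _ := by
            rw [← Real.rpow_natCast, Real.rpow_def_of_pos (by linarith)]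
            push_cast
            rw [mul_comm]
      have h2 : Real.exp (-((j : ℝ) + 1)) ≤ 1 / 2 / 2 ^ j := by
        have h3 : (2 : ℝ) ^ (j + 1) ≤ Real.exp ((j : ℝ) + 1) := by
          have h4 : (2 : ℝ) ≤ Real.exp 1 := by linarith [Real.add_one_le_exp (1 : ℝ)]
          calc (2 : ℝ) ^ (j + 1) ≤ Real.exp 1 ^ (j + 1) := pow_le_pow_left₀ (by norm_num) h4 _
            _ = _ := by rw [← Real.exp_nat_mul]; simp
        rw [Real.exp_neg, div_div, ← pow_succ', one_div]
        exact inv_anti₀ (by positivity) h3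
      have h5 : Real.exp (-A j) = Real.exp (-(3 * 2 ^ j * Real.log N)) *
          (Real.exp (-((j : ℝ) + 1)) * Real.exp (-L)) := by
        rw [← Real.exp_add, ← Real.exp_add]; congr 1; simp only [A]; ring
      calc _ ≤ Real.exp (3 * 2 ^ j * Real.log N) * Real.exp (-A j) := by gcongr
        _ = Real.exp (-((j : ℝ) + 1)) * Real.exp (-L) := by
          rw [h5, ← mul_assoc, ← Real.exp_add, add_neg_cancel, Real.exp_zero, one_mul]
        _ ≤ (1 / 2 / 2 ^ j) * Real.exp (-L) := by gcongr
        _ = _ := mul_comm _ _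
    calc μ.real bad ≤ ∑ j ∈ Finset.range J, ∑ ab, Real.exp (-A j) := by
          refine (measureReal_biUnion_finset_le _ _).trans (Finset.sum_le_sum fun j _ => ?_)
          refine (measureReal_biUnion_finset_le _ _).trans (Finset.sum_le_sum fun ab _ => ?_)
          exact measureReal_predGap_sub_predQuad_ge_le hZ _ _
      _ ≤ ∑ j ∈ Finset.range J, Real.exp (-L) * (1 / 2 / 2 ^ j) :=
          Finset.sum_le_sum fun j _ => hlevel j
      _ = Real.exp (-L) * ∑ j ∈ Finset.range J, 1 / 2 / 2 ^ j := (Finset.mul_sum _ _ _).symm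
      _ ≤ Real.exp (-L) := by
          refine mul_le_of_le_one_right (Real.exp_nonneg _) ?_
          have h := (summable_geometric_two' (1 : ℝ)).sum_le_tsum (Finset.range J)
            fun j _ => by positivity
          rwa [tsum_geometric_two'] at h
  · intro ω hω hq c hc hc1
    have hmass : ∑ z, predMass μ Z ω z = 2 * T := by
      simp only [predMass]
      rw [Finset.sum_comm]
      simp only [Finset.sum_add_distrib, (hq _).2]
      simp
      ring
    have hdiff : ∑ z, predDiff μ Z ω z = 0 := by
      simp only [predDiff]
      rw [Finset.sum_comm]
      simp only [Finset.sum_sub_distrib, (hq _).2]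
      simp
    have habs : ∀ z, |predDiff μ Z ω z| ≤ predMass μ Z ω z := fun z => by
      refine (Finset.abs_sum_le_sum_abs _ _).trans (Finset.sum_le_sum fun t _ => ?_)
      have h1 := (hq t).1 z
      split_ifs <;> rw [abs_le] <;> constructor <;> linarith
    have hlink : ∀ j < J, ∀ (a : Fin (2 ^ j - 1) → ι) (b : Fin (2 ^ (j + 1) - 1) → ι),
        ∑ z, predDiff μ Z ω z * (φ (atomAvg r G _ b z) - φ (atomAvg r G _ a z)) ≤
          η j * ∑ z, predMass μ Z ω z * (φ (atomAvg r G _ b z) - φ (atomAvg r G _ a z)) ^ 2 +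
            A j / η j := by
      intro j hj a b
      have hnot : ¬ A j ≤ predGap μ Z (fun z => η j * D j (a, b) z) ω -
          predQuad μ Z (fun z => η j * D j (a, b) z) ω := fun hcon =>
        hω (Set.mem_biUnion (Finset.mem_range.2 hj)
          (Set.mem_biUnion (Finset.mem_univ (a, b)) hcon))
      have hlt := not_le.1 hnot
      rw [predGap_eq_sum, predQuad_eq_sum] at hlt
      have e1 : ∑ z, predDiff μ Z ω z * (η j * D j (a, b) z) =
          η j * ∑ z, predDiff μ Z ω z * D j (a, b) z := by
        rw [Finset.mul_sum]; exact Finset.sum_congr rfl fun z _ => by ring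
      have e2 : ∑ z, predMass μ Z ω z * (η j * D j (a, b) z) ^ 2 =
          η j * (η j * ∑ z, predMass μ Z ω z * D j (a, b) z ^ 2) := by
        simp only [Finset.mul_sum]; exact Finset.sum_congr rfl fun z _ => by ring
      rw [e1, e2, ← mul_sub] at hlt
      have h := (lt_div_iff₀' (hη j)).2 hlt
      exact (sub_le_iff_le_add'.1 h.le)
    rw [predGap_eq_sum]
    refine (chaining_atomAvg hG hr.le hφ habs hdiff J (fun j => (hη j).le) hlink hc hc1).trans
      (le_of_eq ?_)
    rw [hmass]
    congr 1
    · refine Finset.sum_congr rfl fun j _ => ?_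
      have hRj : 3 * K ^ 2 * r ^ 2 * (2 * T) / 2 ^ j = R j := by simp only [R]; ring
      rw [hRj]
      change η j * R j + A j / η j = 2 * Real.sqrt (R j * A j)
      have hsR : 0 < Real.sqrt (R j) := Real.sqrt_pos.2 (hR j)
      have hsA : 0 < Real.sqrt (A j) := Real.sqrt_pos.2 (hA j)
      have hR2 := Real.mul_self_sqrt (hR j).le
      have hA2 := Real.mul_self_sqrt (hA j).le
      simp only [η]
      rw [Real.sqrt_div (hA j).le, Real.sqrt_mul (hR j).le]
      nth_rewrite 2 [← hR2]
      nth_rewrite 2 [← hA2]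
      field_simp
      ring
    · ring

end Predictive

/-! ### Logistic loss and signed monomials. -/

theorem abs_logisticLoss_sub_le (x y : ℝ) : |logisticLoss x - logisticLoss y| ≤ |x - y| := by
  wlog h : x ≤ y generalizing x y
  · rw [abs_sub_comm, abs_sub_comm x]
    exact this y x (le_of_not_ge h)
  have hx : 0 < Real.exp (-x) := Real.exp_pos _
  have hy : 0 < Real.exp (-y) := Real.exp_pos _
  have hanti : logisticLoss y ≤ logisticLoss x :=
    Real.log_le_log (by linarith) (by gcongr)
  have hgrow : logisticLoss x ≤ (y - x) + logisticLoss y := by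
    rw [logisticLoss, logisticLoss, ← Real.log_exp (y - x),
      ← Real.log_mul (Real.exp_ne_zero _) (by positivity)]
    refine Real.log_le_log (by positivity) ?_
    have h1 : Real.exp (y - x) * Real.exp (-y) = Real.exp (-x) := by
      rw [← Real.exp_add]; congr 1; ring
    have h2 : 1 ≤ Real.exp (y - x) := Real.one_le_exp (by linarith)
    rw [mul_add, h1]
    linarith
  rw [abs_of_nonneg (by linarith), abs_of_nonpos (by linarith)]
  linarith

/-- A signed monomial of degree at most `k`. -/
abbrev SignedMonomial (d k : ℕ) : Type := {S : Finset (Fin d) // S.card ≤ k} × ℤˣ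

/-- The value `y * σ * ∏ i ∈ S, x i` of the signed monomial `(S, σ)` at the sample `(x, y)`. -/
noncomputable def SignedMonomial.value {d k : ℕ} (m : SignedMonomial d k) (z : Cube d × ℤˣ) : ℝ :=
  ((z.2 : ℤ) : ℝ) * (((m.2 : ℤ) : ℝ) * ∏ i ∈ m.1.1, ((z.1 i : ℤ) : ℝ))

theorem abs_intCast_unit (s : ℤˣ) : |((s : ℤ) : ℝ)| = 1 := by
  rcases Int.units_eq_one_or s with h | h <;> simp [h]

theorem SignedMonomial.abs_value_le {d k : ℕ} (m : SignedMonomial d k) (z : Cube d × ℤˣ) :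
    |m.value z| ≤ 1 := by
  simp [SignedMonomial.value, abs_mul, Finset.abs_prod, abs_intCast_unit]

/-- Termwise comparison with the binomial expansion of `(d + 1) ^ k`, using `d.choose i ≤ d ^ i`. -/
theorem card_finset_card_le_le_pow (d k : ℕ) :
    Fintype.card {S : Finset (Fin d) // S.card ≤ k} ≤ (d + 1) ^ k := by
  have hsub : (Finset.univ.filter fun S : Finset (Fin d) => S.card ≤ k) ⊆
      (Finset.range (k + 1)).biUnion fun i => Finset.powersetCard i Finset.univ := by
    intro S hS
    simp only [Finset.mem_biUnion, Finset.mem_range, Finset.mem_powersetCard]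
    exact ⟨S.card, Nat.lt_succ_of_le (Finset.mem_filter.1 hS).2, Finset.subset_univ _, rfl⟩
  rw [Fintype.card_subtype, add_pow]
  refine (Finset.card_le_card hsub).trans (Finset.card_biUnion_le.trans ?_)
  refine Finset.sum_le_sum fun i hi => ?_
  rw [Finset.card_powersetCard, Finset.card_univ, Fintype.card_fin, one_pow, mul_one]
  refine (Nat.choose_le_pow d i).trans (Nat.le_mul_of_pos_right _ ?_)
  exact Nat.choose_pos (Nat.lt_succ_iff.1 (Finset.mem_range.1 hi))

theorem log_card_signedMonomial_le {d k : ℕ} (hd : 2 ≤ d) (hk : 1 ≤ k) :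
    Real.log (Fintype.card (SignedMonomial d k)) ≤ 3 * k * Real.log d := by
  have hcard : Fintype.card (SignedMonomial d k) ≤ d ^ (3 * k) := by
    rw [Fintype.card_prod, Fintype.card_units_int]
    calc _ ≤ (d + 1) ^ k * 2 := Nat.mul_le_mul_right _ (card_finset_card_le_le_pow d k)
      _ ≤ (d ^ 2) ^ k * d ^ k := by
          refine Nat.mul_le_mul (Nat.pow_le_pow_left (by nlinarith) k) ?_
          exact hd.trans (Nat.le_self_pow (by omega) d)
      _ = d ^ (3 * k) := by rw [← pow_mul, ← pow_add]; congr 1; omega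
  have hpos : 0 < Fintype.card (SignedMonomial d k) :=
    Fintype.card_pos_iff.2 ⟨(⟨∅, by simp⟩, 1)⟩
  calc Real.log (Fintype.card (SignedMonomial d k)) ≤ Real.log ((d ^ (3 * k) : ℕ) : ℝ) :=
        Real.log_le_log (by exact_mod_cast hpos) (by exact_mod_cast hcard)
    _ = 3 * k * Real.log d := by push_cast; rw [Real.log_pow]; push_cast; ring

/-- The bounded polynomials are multiples of convex combinations of signed monomials. -/
theorem exists_convex_combination_of_mem_boundedPolys {d k : ℕ} {r : ℝ} (hr : 0 < r)
    {p : CubePoly d} (hp : p ∈ boundedPolys d k r) :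
    ∃ c : SignedMonomial d k → ℝ, (∀ m, 0 ≤ c m) ∧ ∑ m, c m = 1 ∧
      ∀ z : Cube d × ℤˣ, r * ∑ m, c m * m.value z = ((z.2 : ℤ) : ℝ) * p.eval z.1 := by
  obtain ⟨hdeg, hnorm⟩ := hp
  have hsupp : ∀ f : Finset (Fin d) → ℝ, (∀ S, p S = 0 → f S = 0) →
      ∑ S : {S : Finset (Fin d) // S.card ≤ k}, f S.1 = ∑ S, f S := by
    intro f hf
    rw [← Finset.sum_subtype (Finset.univ.filter fun S : Finset (Fin d) => S.card ≤ k)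
      (by simp) f]
    refine Finset.sum_filter_of_ne fun S _ hS => ?_
    exact hdeg S fun h => hS (hf S h)
  set M : ℝ := (Fintype.card {S : Finset (Fin d) // S.card ≤ k} : ℝ) with hM
  have hMpos : 0 < M := Nat.cast_pos.2 (Fintype.card_pos_iff.2 ⟨⟨∅, by simp⟩⟩)
  have hslack : 0 ≤ 1 - p.l1Norm / r := sub_nonneg.2 ((div_le_one hr).2 hnorm)
  have hl1 : ∑ S : {S : Finset (Fin d) // S.card ≤ k}, |p S.1| = p.l1Norm :=
    hsupp (fun S => |p S|) fun S hS => by simp [hS]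
  have hsum_units : ∀ f : ℤˣ → ℝ, ∑ s, f s = f 1 + f (-1) := fun f => by simp
  -- The first part puts `|p S| / r` on the sign of `p S`. The unused mass is spread evenly over
  -- both signs, so it cancels in the value.
  refine ⟨fun m => (((m.2 : ℤ) : ℝ) * p m.1.1 + |p m.1.1|) / (2 * r) +
    (1 - p.l1Norm / r) / (2 * M), fun m => ?_, ?_, fun z => ?_⟩
  · refine add_nonneg (div_nonneg ?_ (by positivity)) (div_nonneg hslack (by positivity))
    have h := neg_abs_le (((m.2 : ℤ) : ℝ) * p m.1.1)
    rw [abs_mul, abs_intCast_unit, one_mul] at h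
    linarith
  · rw [Fintype.sum_prod_type]
    have hterm : ∀ S : {S : Finset (Fin d) // S.card ≤ k},
        ∑ s : ℤˣ, ((((s : ℤ) : ℝ) * p S.1 + |p S.1|) / (2 * r) +
          (1 - p.l1Norm / r) / (2 * M)) = |p S.1| / r + (1 - p.l1Norm / r) / M := fun S => by
      rw [hsum_units]
      push_cast
      field_simp
      ring
    simp only [hterm]
    rw [Finset.sum_add_distrib, ← Finset.sum_div, hl1, Finset.sum_const, Finset.card_univ,
      nsmul_eq_mul, ← hM]
    field_simp
    ring
  · rw [Fintype.sum_prod_type, CubePoly.eval,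
      ← hsupp (fun S => p S * ∏ i ∈ S, ((z.1 i : ℤ) : ℝ)) fun S hS => by simp [hS],
      Finset.mul_sum, Finset.mul_sum]
    refine Finset.sum_congr rfl fun S _ => ?_
    rw [hsum_units]
    simp only [SignedMonomial.value]
    push_cast
    field_simp
    ring

instance instMeasurableSingletonClassUnits {M : Type*} [Monoid M] [MeasurableSpace M]
    [MeasurableSingletonClass M] : MeasurableSingletonClass Mˣ where
  measurableSet_singleton u :=
    ⟨{(u : M)}, measurableSet_singleton _, by ext v; simp [Units.ext_iff]⟩

/-! ### Numerical estimates. -/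

/-- A single term of the chaining sum splits into a capacity part and a geometrically decaying
deviation part. -/
theorem sqrt_chaining_term_le {r T b L : ℝ} (hr : 0 ≤ r) (hT : 0 ≤ T) (hb : 1 / 2 ≤ b)
    (hL : 0 ≤ L) (j : ℕ) :
    Real.sqrt (6 * 2 ^ 2 * r ^ 2 * T / 2 ^ j * (3 * 2 ^ j * b + (j + 1) + L)) ≤
      r * Real.sqrt (120 * T * b) + r * Real.sqrt (24 * T * L) * (3 / 4) ^ j := by
  have hb0 : 0 ≤ b := by linarith
  refine Real.sqrt_le_iff.2 ⟨by positivity, ?_⟩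
  have h1 := Real.sq_sqrt (show 0 ≤ 120 * T * b by positivity)
  have h2 := Real.sq_sqrt (show 0 ≤ 24 * T * L by positivity)
  set x := Real.sqrt (120 * T * b)
  set y := Real.sqrt (24 * T * L)
  have hx : 0 ≤ x := Real.sqrt_nonneg _
  have hy : 0 ≤ y := Real.sqrt_nonneg _
  have hj : (j : ℝ) + 1 ≤ 2 ^ j := by exact_mod_cast Nat.succ_le_of_lt Nat.lt_two_pow_self
  -- The rational ratio `3 / 4` replaces `1 / √2`.
  have hpow : 1 / (2 : ℝ) ^ j ≤ ((3 / 4) ^ j) ^ 2 := by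
    rw [← pow_mul, mul_comm, pow_mul, ← one_div_pow]
    exact pow_le_pow_left₀ (by norm_num) (by norm_num) j
  have hinner : 3 * 2 ^ j * b + (j + 1) + L ≤ 5 * 2 ^ j * b + L := by
    nlinarith [show (0 : ℝ) < 2 ^ j by positivity]
  calc 6 * 2 ^ 2 * r ^ 2 * T / 2 ^ j * (3 * 2 ^ j * b + (j + 1) + L)
      ≤ 6 * 2 ^ 2 * r ^ 2 * T / 2 ^ j * (5 * 2 ^ j * b + L) := by gcongr
    _ = r ^ 2 * (120 * T * b) + r ^ 2 * (24 * T * L) * (1 / 2 ^ j) := by field_simp; ring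
    _ ≤ r ^ 2 * (120 * T * b) + r ^ 2 * (24 * T * L) * ((3 / 4) ^ j) ^ 2 := by gcongr
    _ = (r * x) ^ 2 + (r * y * (3 / 4) ^ j) ^ 2 := by rw [← h1, ← h2]; ring
    _ ≤ _ := by
      have : 0 ≤ (r * x) * (r * y * (3 / 4) ^ j) := by positivity
      nlinarith

theorem natClog_two_le_three_mul_log {T : ℕ} (hT : 2 ≤ T) :
    (Nat.clog 2 T : ℝ) ≤ 3 * Real.log T := by
  have hT0 : (0 : ℝ) < T := by positivity
  have hpos : 0 < Nat.clog 2 T := Nat.clog_pos one_lt_two hT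
  have hlt : (2 : ℝ) ^ (Nat.clog 2 T - 1) < T := by
    exact_mod_cast Nat.pow_pred_clog_lt_self one_lt_two hT
  have hlog := Real.log_le_log (by positivity) hlt.le
  rw [Real.log_pow, Nat.cast_sub hpos] at hlog
  push_cast at hlog
  have hlogT : Real.log 2 ≤ Real.log T := Real.log_le_log two_pos (by exact_mod_cast hT)
  nlinarith [Real.log_two_gt_d9]

theorem chaining_bound_le {k T J : ℕ} {r u b l : ℝ} (hk : 1 ≤ k) (hT : 2 ≤ T) (hr : 0 < r)
    (hu : 0 < u) (hb : 1 / 2 ≤ b) (hl : 1 / 2 ≤ l) (hbl : b ≤ 3 * k * l) (hTJ : (T : ℝ) ≤ 2 ^ J)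
    (hJ : (J : ℝ) ≤ 3 * Real.log T) :
    ∑ j ∈ Finset.range J, 2 * Real.sqrt (6 * 2 ^ 2 * r ^ 2 * T / 2 ^ j *
        (3 * 2 ^ j * b + (j + 1) + u ^ 2 / (2400 * r ^ 2 * T))) +
      2 * 2 * r * T / Real.sqrt (2 ^ J) ≤
    2400 * r * Real.log T ^ (3 / 2 : ℝ) * Real.sqrt (T * k * l) + u := by
  have hT2 : (2 : ℝ) ≤ T := by exact_mod_cast hT
  have hT0 : (0 : ℝ) < T := by linarith
  have hk1 : (1 : ℝ) ≤ k := by exact_mod_cast hk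
  set L := u ^ 2 / (2400 * r ^ 2 * T) with hLdef
  have hL : 0 ≤ L := by positivity
  set s := Real.sqrt (T * k * l) with hs
  have hs0 : 0 ≤ s := Real.sqrt_nonneg _
  have hcap : Real.sqrt (120 * T * b) ≤ 19 * s := by
    refine Real.sqrt_le_iff.2 ⟨by positivity, ?_⟩
    rw [mul_pow, Real.sq_sqrt (by positivity)]
    have h1 : T * b ≤ T * (3 * k * l) := mul_le_mul_of_nonneg_left hbl hT0.le
    have h2 : (0 : ℝ) ≤ T * k * l := by positivity
    nlinarith
  -- The constant `2400 = 24 * 100` is chosen here: doubled and summed geometrically, the deviations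
  -- total at most `4 * u / 5`.
  have hdev : r * Real.sqrt (24 * T * L) = u / 10 := by
    have h1 : 24 * T * L = (u / (10 * r)) ^ 2 := by
      rw [hLdef]; field_simp; ring
    rw [h1, Real.sqrt_sq (by positivity)]
    field_simp
  have hsqrtT : Real.sqrt T ≤ 2 * s := by
    refine Real.sqrt_le_iff.2 ⟨by positivity, ?_⟩
    rw [mul_pow, Real.sq_sqrt (by positivity)]
    have h1 : 1 / 2 ≤ k * l := by nlinarith
    nlinarith
  have htail : T / Real.sqrt (2 ^ J) ≤ 2 * s := by
    refine le_trans ?_ hsqrtT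
    rw [div_le_iff₀ (by positivity)]
    calc (T : ℝ) = Real.sqrt T * Real.sqrt T := (Real.mul_self_sqrt hT0.le).symm
      _ ≤ _ := by gcongr
  have hgeom : ∑ j ∈ Finset.range J, ((3 : ℝ) / 4) ^ j ≤ 4 := by
    have h := geom_sum_eq (show (3 / 4 : ℝ) ≠ 1 by norm_num) J
    rw [h]
    have : (0 : ℝ) ≤ (3 / 4) ^ J := by positivity
    rw [div_le_iff_of_neg (by norm_num)]
    linarith
  have hsum : ∑ j ∈ Finset.range J, 2 * Real.sqrt (6 * 2 ^ 2 * r ^ 2 * T / 2 ^ j *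
      (3 * 2 ^ j * b + (j + 1) + L)) ≤ 38 * J * (r * s) + u := by
    calc _ ≤ ∑ j ∈ Finset.range J, (38 * (r * s) + u / 5 * (3 / 4) ^ j) := by
          refine Finset.sum_le_sum fun j _ => ?_
          have h1 := sqrt_chaining_term_le hr.le hT0.le hb hL j
          rw [hdev] at h1
          have h2 := mul_le_mul_of_nonneg_left hcap hr.le
          linarith
      _ = 38 * J * (r * s) + u / 5 * ∑ j ∈ Finset.range J, (3 / 4) ^ j := by
          rw [Finset.sum_add_distrib, Finset.sum_const, Finset.card_range, nsmul_eq_mul,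
            ← Finset.mul_sum]
          ring
      _ ≤ 38 * J * (r * s) + u / 5 * 4 := by gcongr
      _ ≤ _ := by linarith
  have hlogT : 1 / 2 ≤ Real.log T := by
    have h := Real.log_le_log two_pos hT2
    linarith [Real.log_two_gt_d9]
  have hrpow : Real.log T / 2 ≤ Real.log T ^ (3 / 2 : ℝ) := by
    have h1 : Real.log T ^ (3 / 2 : ℝ) = Real.log T * Real.sqrt (Real.log T) := by
      rw [show (3 / 2 : ℝ) = 1 + 1 / 2 by norm_num, Real.rpow_add (by linarith), Real.rpow_one,
        Real.sqrt_eq_rpow]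
    have h2 : 1 / 2 ≤ Real.sqrt (Real.log T) := Real.le_sqrt_of_sq_le (by linarith)
    rw [h1]
    nlinarith
  have hrs : 0 ≤ r * s := by positivity
  have hlast : 2 * 2 * r * T / Real.sqrt (2 ^ J) ≤ 8 * (r * s) := by
    have h := mul_le_mul_of_nonneg_left htail hr.le
    calc _ = 4 * (r * (T / Real.sqrt (2 ^ J))) := by ring
      _ ≤ _ := by linarith
  have h1 : J * (r * s) ≤ 3 * Real.log T * (r * s) := mul_le_mul_of_nonneg_right hJ hrs
  have h2 : 1 / 2 * (r * s) ≤ Real.log T * (r * s) := mul_le_mul_of_nonneg_right hlogT hrs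
  have h3 : Real.log T / 2 * (r * s) ≤ Real.log T ^ (3 / 2 : ℝ) * (r * s) :=
    mul_le_mul_of_nonneg_right hrpow hrs
  have h4 : 2400 * r * Real.log T ^ (3 / 2 : ℝ) * s =
      2400 * (Real.log T ^ (3 / 2 : ℝ) * (r * s)) := by ring
  rw [h4]
  linarith

/-! ### The main theorem. -/

theorem mainTheorem7 :
    ∃ C : ℝ, 0 < C ∧
      ∀ (d k T : ℕ) (r u : ℝ), 2 ≤ d → 1 ≤ k → k ≤ d → 2 ≤ T → 0 < r → 0 < u →
      ∀ (Ω : Type*) [MeasurableSpace Ω] (μ : Measure Ω) [IsProbabilityMeasure μ]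
        (Z : Fin T → Ω → Cube d × ℤˣ), (∀ t, Measurable (Z t)) →
        μ.real {ω : Ω |
            ((C * r * Real.log T ^ (3 / 2 : ℝ) * Real.sqrt (T * k * Real.log d) + u : ℝ) : EReal)
              < ⨆ p ∈ boundedPolys d k r, (lossGap μ Z p ω : EReal)}
          ≤ Real.exp (-(u ^ 2 / (C * r ^ 2 * T))) := by
  refine ⟨2400, by norm_num, ?_⟩
  intro d k T r u hd hk _ hT hr hu Ω _ μ _ Z hZ
  have : Nonempty (SignedMonomial d k) := ⟨(⟨∅, by simp⟩, 1)⟩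
  have hφ : ∀ x y : ℝ, |logisticLoss (2 * x) - logisticLoss (2 * y)| ≤ 2 * |x - y| := by
    intro x y
    refine (abs_logisticLoss_sub_le _ _).trans_eq ?_
    rw [← mul_sub, abs_mul, abs_two]
  -- With `2 ^ J ≥ T` the truncation error `T / √(2 ^ J)` is at most `√T`.
  obtain ⟨bad, hbad, hgood⟩ := exists_uniform_predGap_le (μ := μ) hZ (by omega)
    (G := SignedMonomial.value (d := d) (k := k)) SignedMonomial.abs_value_le hr
    (φ := fun x => logisticLoss (2 * x)) two_pos hφ (Nat.clog 2 T)
    (L := u ^ 2 / (2400 * r ^ 2 * T)) (by positivity)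
  have hlog2 := Real.log_two_gt_d9
  have hcard : (2 : ℝ) ≤ Fintype.card (SignedMonomial d k) := by
    have h1 : 0 < Fintype.card {S : Finset (Fin d) // S.card ≤ k} :=
      Fintype.card_pos_iff.2 ⟨⟨∅, by simp⟩⟩
    have h2 : 2 ≤ Fintype.card (SignedMonomial d k) := by
      rw [Fintype.card_prod, Fintype.card_units_int]; omega
    exact_mod_cast h2
  have hnum := chaining_bound_le (J := Nat.clog 2 T) hk hT hr hu
    (b := Real.log (Fintype.card (SignedMonomial d k))) (l := Real.log d)
    (by linarith [Real.log_le_log two_pos hcard])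
    (by linarith [Real.log_le_log two_pos (show (2 : ℝ) ≤ d by exact_mod_cast hd)])
    (log_card_signedMonomial_le hd hk) (by exact_mod_cast Nat.le_pow_clog one_lt_two T)
    (natClog_two_le_three_mul_log hT)
  refine le_trans (ENNReal.toReal_mono (measure_ne_top μ bad) (measure_mono_ae ?_)) hbad
  filter_upwards [ae_predProb (μ := μ) hZ, ae_forall_condExp_comp_eq (μ := μ) hZ]
    with ω hprob hcond hω
  by_contra hnot
  refine not_le.2 hω (iSup₂_le fun p hp => EReal.coe_le_coe_iff.2 ?_)
  obtain ⟨c, hc, hc1, hcp⟩ := exists_convex_combination_of_mem_boundedPolys hr hp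
  -- The null set excluded by `hcond` serves all functions at once, which the uncountable supremum
  -- over `p` requires.
  have hgap : lossGap μ Z p ω =
      predGap μ Z (fun z => logisticLoss (2 * (r * ∑ m, c m * m.value z))) ω := by
    have hloss : (fun z => logisticLoss (2 * (r * ∑ m, c m * m.value z))) = sampleLoss p := by
      ext z; rw [hcp, ← mul_assoc, sampleLoss]
    rw [hloss, lossGap, predGap, Finset.sum_sub_distrib]
    congr 1
    exact Finset.sum_congr rfl fun t _ => hcond t _
  rw [hgap]
  exact (hgood ω hnot hprob c hc hc1).trans hnum
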